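/- Let $n\ge 1$ be an integer and let $K$ be an infinite field (of arbitrary characteristic). Let $T=(T_{ijk})_{1\le i,j\le n,\,1\le k\le 2}$ be an $n\times n\times 2$ tensor of independent indeterminates over $K$, with slices $X=(T_{ij1})$ and $Y=(T_{ij2})$, and let $K[T]$ be the polynomial ring in the entries of $T$. Let $G=\mathrm{SL}(n,K)\times\mathrm{SL}(n,K)$ act on $K[T]$ by $K$-algebra automorphisms such that $(P,Q)\in G$ sends $X$ to $P^{\top}XQ$ and $Y$ to $P^{\top}YQ$ (entrywise), and let $K[T]^G$ be the ring of invariants. Write $$\det(X+Y)=f_{n,0}+f_{n-1,1}+\cdots+f_{0,n},$$ where $f_{k,n-k}$ is the bihomogeneous component of degree $k$ in the entries of $X$ and degree $n-k$ in the entries of $Y$. Equip $K[T]$ with the degree lexicographic monomial order for which $$T_{111}>T_{211}>\cdots>T_{n11}>T_{121}>\cdots>T_{n21}>\cdots>T_{nn1}>T_{112}>T_{212}>\cdots>T_{n12}>T_{122}>\cdots>T_{nn2},$$ and write $\mathrm{lm}(f)$ for the leading monomial of a nonzero polynomial $f$. A subset $F$ of a $K$-subalgebra $S\subseteq K[T]$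 is called a sagbi basis of $S$ if the $K$-algebra generated by $\{\mathrm{lm}(f) : f\in S,\ f\ne 0\}$ is generated by $\{\mathrm{lm}(f) : f\in F,\ f\neq 0\}$. Then $f_{n,0},f_{n-1,1},\dots,f_{0,n}$ form a sagbi basis of $K[T]^G$. In particular, $K[T]^G=K[f_{n,0},f_{n-1,1},\dots,f_{0,n}]$. Moreover $f_{n,0},\dots,f_{0,n}$ are algebraically independent over $K$, so that $K[T]^G$ is isomorphic as a $K$-algebra to the polynomial ring in $n+1$ variables over $K$. -/

import Mathlib

open MvPolynomial Matrix
open scoped MatrixGroups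

namespace TensorInv

/-- The index set of the entries of an `n × n × 2` tensor. The triple `(i, j, k)` is stored as
`(k, (j, i))` with the lexicographic order, so that the linear order of the index set is
`T₁₁₁, T₂₁₁, …, Tₙ₁₁, T₁₂₁, …, Tₙₙ₁, T₁₁₂, T₂₁₂, …, Tₙₙ₂` (from the least index to the greatest). -/
abbrev Idx (n : ℕ) : Type := Fin 2 ×ₗ (Fin n ×ₗ Fin n)

/-- The index `(i, j, k)`: row `i`, column `j`, slice `k`. -/
def idx {n : ℕ} (i j : Fin n) (k : Fin 2) : Idx n := toLex (k, toLex (j, i))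

/-- The row of an index. -/
def Idx.row {n : ℕ} (a : Idx n) : Fin n := (ofLex (ofLex a).2).2

/-- The column of an index. -/
def Idx.col {n : ℕ} (a : Idx n) : Fin n := (ofLex (ofLex a).2).1

/-- The slice of an index. -/
def Idx.slc {n : ℕ} (a : Idx n) : Fin 2 := (ofLex a).1

theorem idx_row_col_slc {n : ℕ} (a : Idx n) : idx a.row a.col a.slc = a := rfl

/-- The polynomial ring `K[T]` in the entries of an `n × n × 2` tensor of indeterminates. -/
abbrev Poly (K : Type*) [CommRing K] (n : ℕ) := MvPolynomial (Idx n) K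

/-- The slice `(T_{ijk})_{i,j}` of the tensor of indeterminates, as a matrix over `K[T]`:
`slice K n 0` is `X` and `slice K n 1` is `Y`. -/
noncomputable def slice (K : Type*) [CommRing K] (n : ℕ) (k : Fin 2) :
    Matrix (Fin n) (Fin n) (Poly K n) :=
  Matrix.of fun i j => X (idx i j k)

/-- The `K`-algebra endomorphism of `K[T]` sending each slice `X_k` to `Pᵀ X_k Q`. -/
noncomputable def substHom {K : Type*} [CommRing K] {n : ℕ} (P Q : Matrix (Fin n) (Fin n) K) :
    Poly K n →ₐ[K] Poly K n :=
  aeval fun a : Idx n =>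
    ((P.map C)ᵀ * slice K n a.slc * Q.map C : Matrix (Fin n) (Fin n) (Poly K n)) a.row a.col

theorem substHom_slice {K : Type*} [CommRing K] {n : ℕ} (P Q : Matrix (Fin n) (Fin n) K)
    (k : Fin 2) :
    (slice K n k).map (substHom P Q) = (P.map C)ᵀ * slice K n k * Q.map C := by
  ext1 i j
  simp [substHom, slice, idx, Idx.row, Idx.col, Idx.slc]

theorem map_C_map_substHom {K : Type*} [CommRing K] {n : ℕ} (P Q M : Matrix (Fin n) (Fin n) K) :
    (M.map (C : K →+* Poly K n)).map (substHom P Q) = M.map C := by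
  ext1 i j
  simp [substHom]

theorem substHom_mul {K : Type*} [CommRing K] {n : ℕ} (P P' Q Q' : Matrix (Fin n) (Fin n) K) :
    substHom (P * P') (Q * Q') = (substHom P Q).comp (substHom P' Q') := by
  have h : ∀ k : Fin 2, (slice K n k).map (substHom (P * P') (Q * Q')) =
      ((slice K n k).map (substHom P' Q')).map (substHom P Q) := by
    intro k
    rw [substHom_slice, substHom_slice, Matrix.map_mul, Matrix.map_mul, Matrix.map_mul,
      Matrix.map_mul, ← Matrix.transpose_map,
      map_C_map_substHom, Matrix.transpose_map, map_C_map_substHom, substHom_slice,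
      Matrix.transpose_mul]
    simp only [Matrix.mul_assoc]
  apply MvPolynomial.algHom_ext
  intro a
  exact congrFun (congrFun (h a.slc) a.row) a.col

theorem substHom_one {K : Type*} [CommRing K] {n : ℕ} :
    substHom (1 : Matrix (Fin n) (Fin n) K) 1 = AlgHom.id K (Poly K n) := by
  have h : ∀ k : Fin 2, (slice K n k).map (substHom 1 1) = slice K n k := by
    intro k
    rw [substHom_slice, Matrix.map_one _ (map_zero _) (map_one _)]
    simp
  apply MvPolynomial.algHom_ext
  intro a
  exact congrFun (congrFun (h a.slc) a.row) a.col

/-- The action of `SL(n, K) × SL(n, K)` on `K[T]` by `K`-algebra homomorphisms: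
`(P, Q)` sends `X` to `Pᵀ X Q` and `Y` to `Pᵀ Y Q`. -/
noncomputable def slAction (K : Type*) [CommRing K] (n : ℕ) :
    SpecialLinearGroup (Fin n) K × SpecialLinearGroup (Fin n) K →* (Poly K n →ₐ[K] Poly K n) where
  toFun g := substHom (g.1 : Matrix (Fin n) (Fin n) K) (g.2 : Matrix (Fin n) (Fin n) K)
  map_one' := by simpa using! substHom_one
  map_mul' g h := by simpa using! substHom_mul _ _ _ _

/-- The ring of invariants `K[T]^{SL(n, K) × SL(n, K)}`, as a `K`-subalgebra of `K[T]`. -/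
noncomputable def invariants (K : Type*) [CommRing K] (n : ℕ) : Subalgebra K (Poly K n) where
  carrier := {f | ∀ g, slAction K n g f = f}
  mul_mem' ha hb g := by rw [map_mul, ha g, hb g]
  add_mem' ha hb g := by rw [map_add, ha g, hb g]
  algebraMap_mem' r g := by rw [AlgHom.commutes]

/-- The bidegree of an indeterminate: `(1, 0)` for an entry of `X`, `(0, 1)` for an entry of `Y`. -/
def bideg {n : ℕ} (a : Idx n) : ℕ × ℕ := if a.slc = 0 then (1, 0) else (0, 1)

/-- `fComp K n k` is `f_{k, n-k}`, the bihomogeneous component of `det (X + Y)` of degree `k` in the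
entries of `X` and degree `n - k` in the entries of `Y`, for `0 ≤ k ≤ n`. -/
noncomputable def fComp (K : Type*) [CommRing K] (n : ℕ) (k : Fin (n + 1)) : Poly K n :=
  weightedHomogeneousComponent bideg ((k : ℕ), n - (k : ℕ)) (slice K n 0 + slice K n 1).det

/-- The degree lexicographic monomial order on `K[T]` with
`T₁₁₁ > T₂₁₁ > ⋯ > Tₙ₁₁ > T₁₂₁ > ⋯ > Tₙₙ₁ > T₁₁₂ > T₂₁₂ > ⋯ > Tₙₙ₂`
(for `MonomialOrder.degLex` the smaller index is the larger indeterminate). -/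
noncomputable def monOrder (n : ℕ) : MonomialOrder (Idx n) := MonomialOrder.degLex

/-- The leading monomial (with coefficient `1`) of a nonzero polynomial. -/
noncomputable def leadMon {σ K : Type*} [CommRing K] (m : MonomialOrder σ) (f : MvPolynomial σ K) :
    MvPolynomial σ K :=
  monomial (m.degree f) 1

/-- `F` is a sagbi basis of the subalgebra `S` with respect to the monomial order `m`: the elements
of `F` lie in `S` and their leading monomials generate the initial algebra of `S`, that is, the
`K`-algebra generated by the leading monomials of all nonzero elements of `S`. -/
def IsSagbiBasis {σ K : Type*} [Field K] (m : MonomialOrder σ)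
    (S : Subalgebra K (MvPolynomial σ K)) (F : Set (MvPolynomial σ K)) : Prop :=
  F ⊆ S ∧
    Algebra.adjoin K (leadMon m '' {f | f ∈ F ∧ f ≠ 0}) =
      Algebra.adjoin K (leadMon m '' {f | f ∈ S ∧ f ≠ 0})

end TensorInv

/-!
An invariant of `SL × SL` is determined by its restriction to a section of the action, and the
`f_{k, n-k}` are coordinates on that section.

The monomials of an invariant have equal degrees in all rows and in all columns, since the field is
infinite and diagonal matrices of determinant one act by characters. Hence an invariant is fixed by
every pair `(P, Q)` of invertible matrices with `det P * det Q = 1`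
(`substHom_of_mem_invariants`). This group is large enough to bring a generic pencil to a normal
form without denominators: if `X` is invertible, `A = -X⁻¹ Y`, and `W` is the Krylov matrix with
columns `v, A v, A² v, …`, then `Pᵀ = (X W)⁻¹` and `Q = W diag(1, …, 1, det X)` take `(X, Y)` to
the companion pencil whose nonconstant entries are exactly the values `f_{k, n-k}(X, Y)`, by the
Cayley–Hamilton theorem (`exists_transform_eq_companionPencil`). The condition `det X · det W ≠ 0`
is the nonvanishing of a nonzero polynomial, so every invariant `f` equals the polynomial obtained
by substituting the `f_{k, n-k}` into the restriction of `f` to companion pencils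
(`aeval_companionPencil_of_mem_invariants`), and the `f_{k, n-k}` generate the ring of invariants.

The leading monomial of `f_{k, n-k}` is `x₁₁ ⋯ xₖₖ yₖ₊₁,ₖ₊₁ ⋯ yₙₙ` (`degree_fComp`). The exponents
of these `n + 1` monomials are linearly independent (`sum_smul_leadExp_injective`), so distinct
monomials in the `f_{k, n-k}` have distinct leading monomials, and a nonzero polynomial in them has
as its leading monomial a product of the leading monomials of the `f_{k, n-k}`
(`exists_degree_aeval_eq`). This yields both the algebraic independence and the sagbi property.
-/

namespace TensorInv

/-! ### The monomials of `det (X + Y)` -/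

/-- The exponent of the monomial `∏ j, T_{σ j, j, s j}` picked out of the Leibniz expansion of
`det (X + Y)` by a permutation `σ` and a choice `s` of a slice for each column. -/
noncomputable def selExp {n : ℕ} (σ : Equiv.Perm (Fin n)) (s : Fin n → Fin 2) : Idx n →₀ ℕ :=
  ∑ j, Finsupp.single (idx (σ j) j (s j)) 1

theorem idx_inj {n : ℕ} {i j i' j' : Fin n} {k k' : Fin 2} :
    idx i j k = idx i' j' k' ↔ i = i' ∧ j = j' ∧ k = k' := by
  constructor
  · intro h
    exact ⟨congrArg Idx.row h, congrArg Idx.col h, congrArg Idx.slc h⟩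
  · rintro ⟨rfl, rfl, rfl⟩
    rfl

theorem selExp_apply {n : ℕ} (σ : Equiv.Perm (Fin n)) (s : Fin n → Fin 2) (i j : Fin n)
    (k : Fin 2) : selExp σ s (idx i j k) = if σ j = i ∧ s j = k then 1 else 0 := by
  rw [selExp, Finsupp.finsetSum_apply, Finset.sum_eq_single j]
  · simp [Finsupp.single_apply, idx_inj]
  · intro b _ hb
    simp [idx_inj, hb]
  · simp

theorem selExp_injective {n : ℕ} :
    Function.Injective fun p : Equiv.Perm (Fin n) × (Fin n → Fin 2) => selExp p.1 p.2 := by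
  rintro ⟨σ, s⟩ ⟨τ, t⟩ h
  have key : ∀ j, τ j = σ j ∧ t j = s j := by
    intro j
    have h' := DFunLike.congr_fun h (idx (σ j) j (s j))
    simp only [selExp_apply] at h'
    by_contra hc
    simp [hc] at h'
  exact Prod.ext (Equiv.ext fun j => (key j).1.symm) (funext fun j => (key j).2.symm)

theorem det_slice_add_slice (K : Type*) [CommRing K] (n : ℕ) :
    (slice K n 0 + slice K n 1).det =
      ∑ p : Equiv.Perm (Fin n) × (Fin n → Fin 2),
        monomial (selExp p.1 p.2) (((Equiv.Perm.sign p.1 : ℤ) : K)) := by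
  rw [Matrix.det_apply', Fintype.sum_prod_type]
  refine Finset.sum_congr rfl fun σ _ => ?_
  have h1 : ∀ j, (slice K n 0 + slice K n 1) (σ j) j =
      ∑ k : Fin 2, (X (idx (σ j) j k) : Poly K n) := by
    intro j
    simp [slice, Fin.sum_univ_two]
  have h2 : ∀ s : Fin n → Fin 2, ∏ j, (X (idx (σ j) j (s j)) : Poly K n) =
      monomial (selExp σ s) 1 := by
    intro s
    rw [selExp, monomial_sum_one]
    rfl
  simp_rw [h1, Finset.prod_univ_sum, Fintype.piFinset_univ, Finset.mul_sum, h2]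
  refine Finset.sum_congr rfl fun s _ => ?_
  rw [← map_intCast (C : K →+* Poly K n), C_mul_monomial, mul_one]

theorem coeff_selExp_det {K : Type*} [CommRing K] {n : ℕ} (σ : Equiv.Perm (Fin n))
    (s : Fin n → Fin 2) :
    coeff (selExp σ s) (slice K n 0 + slice K n 1).det = ((Equiv.Perm.sign σ : ℤ) : K) := by
  classical
  rw [det_slice_add_slice, coeff_sum, Finset.sum_eq_single (σ, s)]
  · simp
  · intro p _ hp
    rw [coeff_monomial, if_neg]
    exact fun h => hp (selExp_injective h)
  · simp

theorem exists_selExp_of_coeff_det_ne_zero {K : Type*} [CommRing K] {n : ℕ} {d : Idx n →₀ ℕ}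
    (h : coeff d (slice K n 0 + slice K n 1).det ≠ 0) : ∃ σ s, selExp σ s = d := by
  classical
  rw [det_slice_add_slice, coeff_sum] at h
  obtain ⟨p, _, hp⟩ := Finset.exists_ne_zero_of_sum_ne_zero h
  rw [coeff_monomial] at hp
  exact ⟨p.1, p.2, by_contra fun hc => hp (if_neg hc)⟩

theorem weight_bideg_selExp {n : ℕ} (σ : Equiv.Perm (Fin n)) (s : Fin n → Fin 2) :
    Finsupp.weight bideg (selExp σ s) =
      ((Finset.univ.filter fun j => s j = 0).card,
        n - (Finset.univ.filter fun j => s j = 0).card) := by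
  have h1 : Finsupp.weight bideg (selExp σ s) =
      ∑ j, ((if s j = 0 then 1 else 0, if s j = 0 then 0 else 1) : ℕ × ℕ) := by
    rw [selExp, map_sum]
    refine Finset.sum_congr rfl fun j _ => ?_
    rw [Finsupp.weight_single, one_smul, bideg]
    change (if s j = 0 then _ else _) = _
    split_ifs <;> rfl
  have h2 := Finset.card_filter_add_card_filter_not (s := (Finset.univ : Finset (Fin n)))
    (fun j => s j = 0)
  rw [Finset.card_univ, Fintype.card_fin] at h2
  rw [h1, Prod.ext_iff, Prod.fst_sum, Prod.snd_sum]
  constructor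
  · simp
  · simp only [Finset.sum_ite, Finset.sum_const_zero, Finset.sum_const, smul_eq_mul, mul_one,
      zero_add]
    omega

theorem degree_selExp {n : ℕ} (σ : Equiv.Perm (Fin n)) (s : Fin n → Fin 2) :
    Finsupp.degree (selExp σ s) = n := by
  simp [selExp]

/-- The slice choice that takes the first `k` columns from `X` and the others from `Y`. -/
def initSlice (n k : ℕ) (j : Fin n) : Fin 2 := if (j : ℕ) < k then 0 else 1

theorem initSlice_eq_zero {n k : ℕ} {j : Fin n} : initSlice n k j = 0 ↔ (j : ℕ) < k := by
  unfold initSlice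
  split_ifs <;> simp_all

theorem initSlice_eq_one {n k : ℕ} {j : Fin n} : initSlice n k j = 1 ↔ k ≤ (j : ℕ) := by
  unfold initSlice
  split_ifs <;> simp_all

theorem card_initSlice {n k : ℕ} (hk : k ≤ n) :
    (Finset.univ.filter fun j => initSlice n k j = 0).card = k := by
  simp_rw [initSlice_eq_zero]
  rw [Fin.card_filter_val_lt, min_eq_right hk]

/-- The exponent of `x₁₁ ⋯ xₖₖ yₖ₊₁,ₖ₊₁ ⋯ yₙₙ`. -/
noncomputable def leadExp (n k : ℕ) : Idx n →₀ ℕ := selExp 1 (initSlice n k)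

theorem leadExp_apply {n : ℕ} (k : ℕ) (i j : Fin n) (l : Fin 2) :
    leadExp n k (idx i j l) = if j = i ∧ initSlice n k j = l then 1 else 0 :=
  selExp_apply _ _ _ _ _

theorem idx_lt_idx {n : ℕ} {i j i' j' : Fin n} {k k' : Fin 2} :
    idx i j k < idx i' j' k' ↔ k < k' ∨ k = k' ∧ (j < j' ∨ j = j' ∧ i < i') := by
  simp only [idx, Prod.Lex.toLex_lt_toLex]

/-- Among the squarefree monomials of `det (X + Y)` of bidegree `(k, n - k)`, the diagonal monomial
`x₁₁ ⋯ xₖₖ yₖ₊₁,ₖ₊₁ ⋯ yₙₙ` is the largest. -/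
theorem selExp_le_leadExp {n k : ℕ} (σ : Equiv.Perm (Fin n)) (s : Fin n → Fin 2)
    (hs : (Finset.univ.filter fun j => s j = 0).card = k) :
    (monOrder n).toSyn (selExp σ s) ≤ (monOrder n).toSyn (leadExp n k) := by
  by_cases hne : selExp σ s = leadExp n k
  · rw [hne]
  refine le_of_lt ?_
  rw [monOrder, MonomialOrder.degLex_lt_iff, Finsupp.DegLex.lt_iff]
  refine Or.inr ⟨by simp [leadExp, degree_selExp], ?_⟩
  rw [Finsupp.Lex.lt_iff]
  -- At the first index where they differ the exponents are `0` and `1`, in an order to be found.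
  have hex : ∃ a, selExp σ s a ≠ leadExp n k a := by
    by_contra! hc
    exact hne (Finsupp.ext hc)
  obtain ⟨a, ha, hmin⟩ := WellFounded.has_min (wellFounded_lt (α := Idx n))
    {a | selExp σ s a ≠ leadExp n k a} hex
  have hlow : ∀ b, b < a → selExp σ s b = leadExp n k b := fun b hb => by
    by_contra hc
    exact hmin b hc hb
  refine ⟨a, hlow, ?_⟩
  obtain ⟨r, i, l, rfl⟩ : ∃ r i l, idx r i l = a := ⟨_, _, _, idx_row_col_slc a⟩
  change selExp σ s _ < leadExp n k _
  change selExp σ s _ ≠ leadExp n k _ at ha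
  rw [selExp_apply, leadExp_apply] at ha ⊢
  -- In the other order, column `i` of the first monomial holds an off-diagonal entry, or an entry
  -- of the wrong slice, although all earlier columns agree with the diagonal.
  by_cases h2 : i = r ∧ initSlice n k i = l
  · rw [if_pos h2] at ha ⊢
    have : ¬ (σ i = r ∧ s i = l) := fun h => ha (if_pos h)
    rw [if_neg this]
    exact Nat.zero_lt_one
  exfalso
  have h1 : σ i = r ∧ s i = l := by
    by_contra h1
    exact ha (by rw [if_neg h1, if_neg h2])
  obtain ⟨rfl, rfl⟩ := h1
  have hd : ∀ j l', initSlice n k j = l' → idx j j l' < idx (σ i) i (s i) →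
      σ j = j ∧ s j = l' := by
    intro j l' hj hlt
    have := hlow _ hlt
    rw [leadExp_apply, if_pos ⟨rfl, hj⟩, selExp_apply] at this
    by_contra hc
    rw [if_neg hc] at this
    exact absurd this (by norm_num)
  have hle : (∀ j, j < i → σ j = j) → i ≤ σ i := by
    intro h
    by_contra! hlt
    exact hlt.ne (σ.injective (h _ hlt))
  obtain hsi | hsi : s i = 0 ∨ s i = 1 := by
    generalize s i = q
    revert q
    decide
  · rcases lt_or_ge (i : ℕ) k with hik | hik
    · have hfix : ∀ j, j < i → σ j = j := fun j hj =>
        (hd j 0 (initSlice_eq_zero.2 (lt_trans hj hik))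
          (idx_lt_idx.2 (Or.inr ⟨hsi.symm, Or.inl hj⟩))).1
      have hne' : i ≠ σ i := fun h => h2 ⟨h, by rw [hsi]; exact initSlice_eq_zero.2 hik⟩
      exact hne' (hd i 0 (initSlice_eq_zero.2 hik) (idx_lt_idx.2
        (Or.inr ⟨hsi.symm, Or.inr ⟨rfl, lt_of_le_of_ne (hle hfix) hne'⟩⟩))).1.symm
    · -- The first `k` columns and column `i` would be `k + 1` columns taken from `X`.
      have hsub : insert i (Finset.univ.filter fun j => initSlice n k j = 0) ⊆
          Finset.univ.filter fun j => s j = 0 := by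
        intro j hj
        rw [Finset.mem_insert, Finset.mem_filter] at hj
        rw [Finset.mem_filter]
        refine ⟨Finset.mem_univ _, ?_⟩
        rcases hj with rfl | ⟨-, hj⟩
        · exact hsi
        · exact (hd j 0 hj (idx_lt_idx.2 (Or.inr ⟨hsi.symm,
            Or.inl (Fin.lt_def.2 (lt_of_lt_of_le (initSlice_eq_zero.1 hj) hik))⟩))).2
      have hc := Finset.card_le_card hsub
      rw [Finset.card_insert_of_notMem (by simp [initSlice_eq_zero, hik]),
        card_initSlice (hik.trans i.2.le), hs] at hc
      omega
  · have hX : ∀ j : Fin n, (j : ℕ) < k → σ j = j ∧ s j = 0 := fun j hj =>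
      hd j 0 (initSlice_eq_zero.2 hj) (idx_lt_idx.2 (Or.inl (by rw [hsi]; decide)))
    have hkn : k ≤ n := by
      rw [← hs]
      simpa using Finset.card_filter_le (Finset.univ : Finset (Fin n)) (fun j => s j = 0)
    have hik : k ≤ (i : ℕ) := by
      by_contra! hik
      rw [(hX i hik).2] at hsi
      exact absurd hsi (by decide)
    have hfix : ∀ j, j < i → σ j = j := by
      intro j hj
      rcases lt_or_ge (j : ℕ) k with hjk | hjk
      · exact (hX j hjk).1
      · exact (hd j 1 (initSlice_eq_one.2 hjk) (idx_lt_idx.2 (Or.inr ⟨hsi.symm, Or.inl hj⟩))).1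
    have hne' : i ≠ σ i := fun h => h2 ⟨h, by rw [hsi]; exact initSlice_eq_one.2 hik⟩
    exact hne' (hd i 1 (initSlice_eq_one.2 hik) (idx_lt_idx.2
      (Or.inr ⟨hsi.symm, Or.inr ⟨rfl, lt_of_le_of_ne (hle hfix) hne'⟩⟩))).1.symm

/-! ### The leading monomials of the `f_{k, n-k}` -/

theorem coeff_fComp {K : Type*} [CommRing K] {n : ℕ} (k : Fin (n + 1)) (d : Idx n →₀ ℕ) :
    coeff d (fComp K n k) = if Finsupp.weight bideg d = ((k : ℕ), n - (k : ℕ)) then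
      coeff d (slice K n 0 + slice K n 1).det else 0 := by
  rw [fComp, coeff_weightedHomogeneousComponent]

theorem coeff_leadExp_fComp {K : Type*} [CommRing K] {n : ℕ} (k : Fin (n + 1)) :
    coeff (leadExp n k) (fComp K n k) = 1 := by
  rw [coeff_fComp, if_pos, leadExp, coeff_selExp_det]
  · simp
  · rw [leadExp, weight_bideg_selExp, card_initSlice (Nat.lt_succ_iff.1 k.2)]

theorem degree_fComp {K : Type*} [Field K] {n : ℕ} (k : Fin (n + 1)) :
    (monOrder n).degree (fComp K n k) = leadExp n k := by
  apply (monOrder n).toSyn.injective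
  apply le_antisymm
  · rw [MonomialOrder.degree_le_iff]
    intro d hd
    rw [mem_support_iff, coeff_fComp] at hd
    obtain ⟨hw, hc⟩ : _ ∧ _ := by simpa using hd
    obtain ⟨σ, s, rfl⟩ := exists_selExp_of_coeff_det_ne_zero hc
    rw [weight_bideg_selExp, Prod.ext_iff] at hw
    exact selExp_le_leadExp σ s hw.1
  · apply MonomialOrder.le_degree
    rw [mem_support_iff, coeff_leadExp_fComp]
    exact one_ne_zero

theorem monic_fComp {K : Type*} [Field K] {n : ℕ} (k : Fin (n + 1)) :
    (monOrder n).Monic (fComp K n k) := by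
  rw [MonomialOrder.Monic, MonomialOrder.leadingCoeff, degree_fComp, coeff_leadExp_fComp]

/-- The exponents of the leading monomials are linearly independent: the coefficients `e` are
recovered from the exponents of `y₁₁, …, yₙₙ`, which are the partial sums of `e`, and from the
exponent `e₁ + ⋯ + eₙ` of `x₁₁`. -/
theorem sum_smul_leadExp_injective {n : ℕ} (hn : 1 ≤ n) :
    Function.Injective fun e : Fin (n + 1) →₀ ℕ => ∑ k, e k • leadExp n k := by
  intro e e' h
  have hY : ∀ (e : Fin (n + 1) →₀ ℕ) (i : Fin n), (∑ k, e k • leadExp n k) (idx i i 1) =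
      ∑ k : Fin (n + 1), if (k : ℕ) ≤ i then e k else 0 := by
    intro e i
    rw [Finsupp.finsetSum_apply]
    refine Finset.sum_congr rfl fun k _ => ?_
    simp [leadExp_apply, initSlice_eq_one]
  have hX : ∀ (e : Fin (n + 1) →₀ ℕ) (i : Fin n), (∑ k, e k • leadExp n k) (idx i i 0) =
      ∑ k : Fin (n + 1), if (i : ℕ) < k then e k else 0 := by
    intro e i
    rw [Finsupp.finsetSum_apply]
    refine Finset.sum_congr rfl fun k _ => ?_
    simp [leadExp_apply, initSlice_eq_zero]
  have hsum : ∀ i : Fin n, (∑ k : Fin (n + 1), if (k : ℕ) ≤ i then e k else 0) =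
      ∑ k : Fin (n + 1), if (k : ℕ) ≤ i then e' k else 0 := fun i => by
    rw [← hY, ← hY]
    exact DFunLike.congr_fun h _
  have htot : ∑ k, e k = ∑ k, e' k := by
    have h0 : ∀ (e : Fin (n + 1) →₀ ℕ), ∑ k, e k =
        (∑ k, e k • leadExp n k) (idx ⟨0, hn⟩ ⟨0, hn⟩ 1) +
          (∑ k, e k • leadExp n k) (idx ⟨0, hn⟩ ⟨0, hn⟩ 0) := by
      intro e
      rw [hX, hY, ← Finset.sum_add_distrib]
      refine Finset.sum_congr rfl fun k _ => ?_
      simp only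
      split_ifs <;> omega
    rw [h0, h0]
    simp only at h
    rw [h]
  have hsum' : ∀ i : ℕ, (∑ k : Fin (n + 1), if (k : ℕ) ≤ i then e k else 0) =
      ∑ k : Fin (n + 1), if (k : ℕ) ≤ i then e' k else 0 := by
    intro i
    by_cases hi : i < n
    · exact hsum ⟨i, hi⟩
    · have : ∀ k : Fin (n + 1), (k : ℕ) ≤ i := fun k => by omega
      simpa [this] using htot
  have hstep : ∀ (e : Fin (n + 1) →₀ ℕ) (i : Fin (n + 1)),
      (∑ k : Fin (n + 1), if (k : ℕ) ≤ i then e k else 0) =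
        (∑ k : Fin (n + 1), if (k : ℕ) < i then e k else 0) + e i := by
    intro e i
    have hi : e i = ∑ k, if k = i then e k else 0 := by simp
    rw [hi, ← Finset.sum_add_distrib]
    refine Finset.sum_congr rfl fun k _ => ?_
    rcases lt_trichotomy k i with hk | rfl | hk
    · simp [hk.le, hk, hk.ne]
    · simp
    · simp [hk.not_ge, hk.not_gt, hk.ne']
  ext i
  have h1 := hstep e i
  have h2 := hstep e' i
  have h3 : (∑ k : Fin (n + 1), if (k : ℕ) < i then e k else 0) =
      ∑ k : Fin (n + 1), if (k : ℕ) < i then e' k else 0 := by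
    rcases Nat.eq_zero_or_pos (i : ℕ) with hi | hi
    · simp [hi]
    · have := hsum' (i - 1)
      simp_rw [Nat.le_sub_one_iff_lt hi] at this
      exact this
  have h4 := hsum' i
  omega

/-- The leading monomial of a polynomial in algebraically independent leading monomials: distinct
monomials in the `g k` have distinct leading exponents, so no cancellation of leading terms can
occur. -/
theorem exists_degree_aeval_eq {K σ ι : Type*} [Field K] [Fintype ι] (m : MonomialOrder σ)
    (g : ι → MvPolynomial σ K) (hg : ∀ k, m.Monic (g k))
    (hinj : Function.Injective fun e : ι →₀ ℕ => ∑ k, e k • m.degree (g k))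
    {h : MvPolynomial ι K} (hh : h ≠ 0) :
    aeval g h ≠ 0 ∧ ∃ e : ι →₀ ℕ, m.degree (aeval g h) = ∑ k, e k • m.degree (g k) := by
  have hmon : ∀ e : ι →₀ ℕ, m.Monic (∏ k, g k ^ e k) := fun e =>
    MonomialOrder.Monic.prod fun k _ => (hg k).pow
  have hdeg : ∀ e : ι →₀ ℕ, m.degree (∏ k, g k ^ e k) = ∑ k, e k • m.degree (g k) := fun e => by
    rw [MonomialOrder.degree_prod fun k _ => pow_ne_zero _ (hg k).ne_zero]
    simp [MonomialOrder.degree_pow]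
  obtain ⟨e, he, hmax⟩ := h.support.exists_max_image
    (fun e => m.toSyn (∑ k, e k • m.degree (g k))) (by simpa using hh)
  have hexp : aeval g h = ∑ e ∈ h.support, C (coeff e h) * ∏ k, g k ^ e k := by
    rw [aeval_def, eval₂_eq']
    rfl
  have hcoeff : coeff (∑ k, e k • m.degree (g k)) (aeval g h) = coeff e h := by
    rw [hexp, coeff_sum, Finset.sum_eq_single_of_mem e he]
    · rw [coeff_C_mul, ← hdeg]
      have := (hmon e).coeff_degree
      rw [this, mul_one]
    · intro e' he' hne
      rw [coeff_C_mul, MonomialOrder.coeff_eq_zero_of_lt (f := ∏ k, g k ^ e' k), mul_zero]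
      rw [hdeg]
      refine lt_of_le_of_ne (hmax e' he') fun hc => hne (hinj (m.toSyn.injective hc))
  have hsupp : (∑ k, e k • m.degree (g k)) ∈ (aeval g h).support := by
    rw [mem_support_iff, hcoeff]
    exact mem_support_iff.1 he
  refine ⟨fun h0 => by rw [h0] at hsupp; simp at hsupp, e, m.toSyn.injective (le_antisymm ?_
    (MonomialOrder.le_degree hsupp))⟩
  rw [hexp]
  refine MonomialOrder.degree_sum_le.trans (Finset.sup_le fun e' he' => ?_)
  refine le_trans ?_ (hmax e' he')
  rw [← hdeg]
  simpa using MonomialOrder.degree_mul_le (m := m) (f := C (coeff e' h)) (g := ∏ k, g k ^ e' k)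

/-! ### Tensors over `K` and the invariance of the `f_{k, n-k}` -/

/-- The slice `k` of a tensor with entries in `R`, as a matrix. -/
def sliceAt {R : Type*} {n : ℕ} (x : Idx n → R) (k : Fin 2) : Matrix (Fin n) (Fin n) R :=
  Matrix.of fun i j => x (idx i j k)

theorem eval_substHom {K : Type*} [CommRing K] {n : ℕ} (P Q : Matrix (Fin n) (Fin n) K)
    (x : Idx n → K) (f : Poly K n) :
    eval x (substHom P Q f) =
      eval (fun a => (Pᵀ * sliceAt x a.slc * Q) a.row a.col) f := by
  have h : ((aeval x : Poly K n →ₐ[K] K).comp (substHom P Q)) =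
      aeval fun a => (Pᵀ * sliceAt x a.slc * Q) a.row a.col := by
    apply MvPolynomial.algHom_ext
    intro a
    simp [substHom, Matrix.mul_apply, slice, sliceAt]
  have := DFunLike.congr_fun h f
  simpa [aeval_eq_eval] using this

theorem sum_fComp (K : Type*) [CommRing K] (n : ℕ) :
    ∑ k : Fin (n + 1), fComp K n k = (slice K n 0 + slice K n 1).det := by
  ext d
  rw [coeff_sum]
  simp_rw [coeff_fComp]
  by_cases hd : coeff d (slice K n 0 + slice K n 1).det = 0
  · simp [hd]
  obtain ⟨σ, s, rfl⟩ := exists_selExp_of_coeff_det_ne_zero hd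
  have hle : (Finset.univ.filter fun j => s j = 0).card < n + 1 := by
    have := Finset.card_filter_le (Finset.univ : Finset (Fin n)) (fun j => s j = 0)
    rw [Finset.card_univ, Fintype.card_fin] at this
    omega
  rw [weight_bideg_selExp, Finset.sum_eq_single ⟨_, hle⟩]
  · rw [if_pos rfl]
  · intro k _ hk
    rw [if_neg]
    intro hc
    exact hk (Fin.ext (Prod.ext_iff.1 hc).1.symm)
  · simp

/-- Scaling the `X`-slice by `t` multiplies a form of bidegree `(k, l)` by `tᵏ`. -/
theorem aeval_scale_of_weight {K : Type*} [CommRing K] {n : ℕ} (x : Idx n → K) {p : Poly K n}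
    {k l : ℕ} (hp : ∀ d ∈ p.support, Finsupp.weight bideg d = (k, l)) :
    aeval (fun a : Idx n => Polynomial.X ^ (bideg a).1 * Polynomial.C (x a)) p =
      Polynomial.C (eval x p) * Polynomial.X ^ k := by
  rw [aeval_def, eval₂_eq', eval_eq', map_sum, Finset.sum_mul]
  refine Finset.sum_congr rfl fun d hd => ?_
  have hw : ∑ a, (bideg a).1 * d a = k := by
    have h := congrArg Prod.fst (hp d hd)
    rw [Finsupp.weight_apply, Finsupp.sum_fintype _ _ (by simp), Prod.fst_sum] at h
    simpa [mul_comm] using h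
  simp_rw [mul_pow, Finset.prod_mul_distrib, ← pow_mul]
  rw [Finset.prod_pow_eq_pow_sum, hw, map_mul, map_prod]
  simp_rw [map_pow]
  rw [Polynomial.algebraMap_eq]
  ring

/-- `det (t X + Y) = ∑ f_{k, n-k} tᵏ`, at every tensor over `K`. -/
theorem sum_eval_fComp_mul_X_pow {K : Type*} [CommRing K] {n : ℕ} (x : Idx n → K) :
    ∑ k : Fin (n + 1), Polynomial.C (eval x (fComp K n k)) * Polynomial.X ^ (k : ℕ) =
      ((Polynomial.X : Polynomial K) • (sliceAt x 0).map Polynomial.C +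
        (sliceAt x 1).map Polynomial.C).det := by
  have h := congrArg
    (aeval (fun a : Idx n => Polynomial.X ^ (bideg a).1 * Polynomial.C (x a))) (sum_fComp K n)
  rw [map_sum, AlgHom.map_det] at h
  refine (Finset.sum_congr rfl fun k _ => ?_).trans (h.trans (congrArg _ ?_))
  · refine (aeval_scale_of_weight x (l := n - k) fun d hd => ?_).symm
    rw [mem_support_iff, coeff_fComp] at hd
    by_contra hc
    exact hd (if_neg hc)
  · ext1 i j
    simp [slice, sliceAt, bideg, Idx.slc, idx]

theorem eval_fComp_eq_coeff {K : Type*} [CommRing K] {n : ℕ} (x : Idx n → K) (k : Fin (n + 1)) :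
    eval x (fComp K n k) = ((Polynomial.X : Polynomial K) • (sliceAt x 0).map Polynomial.C +
        (sliceAt x 1).map Polynomial.C).det.coeff k := by
  rw [← sum_eval_fComp_mul_X_pow, Polynomial.finsetSum_coeff]
  simp_rw [Polynomial.coeff_C_mul_X_pow, Fin.val_inj]
  simp

theorem fComp_mem_invariants (K : Type*) [Field K] [Infinite K] (n : ℕ) (k : Fin (n + 1)) :
    fComp K n k ∈ invariants K n := by
  rintro ⟨P, Q⟩
  change substHom (P : Matrix (Fin n) (Fin n) K) Q _ = _
  apply MvPolynomial.funext
  intro x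
  rw [eval_substHom, eval_fComp_eq_coeff, eval_fComp_eq_coeff]
  congr 1
  have h : ∀ l, sliceAt (fun a : Idx n => ((P : Matrix (Fin n) (Fin n) K)ᵀ * sliceAt x a.slc *
      (Q : Matrix (Fin n) (Fin n) K)) a.row a.col) l =
      (P : Matrix (Fin n) (Fin n) K)ᵀ * sliceAt x l * (Q : Matrix (Fin n) (Fin n) K) :=
    fun l => rfl
  rw [h, h]
  simp_rw [Matrix.map_mul]
  rw [← Matrix.smul_mul, ← Matrix.mul_smul, ← Matrix.add_mul, ← Matrix.mul_add, Matrix.det_mul,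
    Matrix.det_mul]
  have hdet : ∀ M : Matrix (Fin n) (Fin n) K,
      (M.map (Polynomial.C : K →+* Polynomial K)).det = Polynomial.C M.det :=
    fun M => (RingHom.map_det _ _).symm
  rw [hdet, hdet, Matrix.det_transpose, P.2, Q.2]
  simp

/-! ### Torus weights -/

theorem substHom_diagonal_X {K : Type*} [CommRing K] {n : ℕ} (p q : Fin n → K) (a : Idx n) :
    substHom (diagonal p) (diagonal q) (X a) = C (p a.row * q a.col) * X a := by
  rw [substHom, aeval_X, diagonal_map (map_zero _), diagonal_map (map_zero _), diagonal_transpose,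
    Matrix.mul_diagonal, Matrix.diagonal_mul, C_mul]
  change C (p a.row) * X a * C (q a.col) = _
  ring

theorem coeff_substHom_diagonal {K : Type*} [CommRing K] {n : ℕ} (p q : Fin n → K)
    (f : Poly K n) (d : Idx n →₀ ℕ) :
    coeff d (substHom (diagonal p) (diagonal q) f) =
      (∏ a, (p a.row * q a.col) ^ d a) * coeff d f := by
  classical
  induction f using MvPolynomial.induction_on' with
  | monomial u c =>
    have : substHom (diagonal p) (diagonal q) (monomial u c) =
        monomial u ((∏ a, (p a.row * q a.col) ^ u a) * c) := by
      rw [monomial_eq, map_mul, Finsupp.prod_fintype _ _ (by simp), map_prod]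
      rw [monomial_eq, Finsupp.prod_fintype _ _ (by simp)]
      simp only [map_pow, substHom_diagonal_X, mul_pow, C_mul, map_prod, Finset.prod_mul_distrib,
        algHom_C, algebraMap_eq]
      ring
    rw [this, coeff_monomial, coeff_monomial]
    split_ifs with h
    · rw [h]
    · simp
  | add f g hf hg => rw [map_add, coeff_add, coeff_add, hf, hg, mul_add]

/-- The degree of a monomial in the entries of row `i` of the two slices. -/
def rowDeg {n : ℕ} (d : Idx n →₀ ℕ) (i : Fin n) : ℕ := ∑ a with Idx.row a = i, d a

/-- The degree of a monomial in the entries of column `j` of the two slices. -/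
def colDeg {n : ℕ} (d : Idx n →₀ ℕ) (j : Fin n) : ℕ := ∑ a with Idx.col a = j, d a

theorem prod_weight_eq {K : Type*} [CommRing K] {n : ℕ} (p q : Fin n → K) (d : Idx n →₀ ℕ) :
    ∏ a : Idx n, (p a.row * q a.col) ^ d a = (∏ i, p i ^ rowDeg d i) * ∏ j, q j ^ colDeg d j := by
  simp_rw [mul_pow]
  rw [Finset.prod_mul_distrib, ← Finset.prod_fiberwise _ Idx.row,
    ← Finset.prod_fiberwise Finset.univ Idx.col fun a : Idx n => q a.col ^ d a]
  congr 1
  · refine Finset.prod_congr rfl fun i _ => ?_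
    rw [rowDeg, ← Finset.prod_pow_eq_pow_sum]
    refine Finset.prod_congr rfl fun a ha => ?_
    rw [(Finset.mem_filter.1 ha).2]
  · refine Finset.prod_congr rfl fun i _ => ?_
    rw [colDeg, ← Finset.prod_pow_eq_pow_sum]
    refine Finset.prod_congr rfl fun a ha => ?_
    rw [(Finset.mem_filter.1 ha).2]

theorem sum_rowDeg_eq_sum_colDeg {n : ℕ} (d : Idx n →₀ ℕ) :
    ∑ i, rowDeg d i = ∑ j, colDeg d j := by
  simp_rw [rowDeg, colDeg]
  rw [Finset.sum_fiberwise, Finset.sum_fiberwise]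

theorem eq_of_forall_pow_eq_pow {K : Type*} [Field K] [Infinite K] {a b : ℕ}
    (h : ∀ t : K, t ≠ 0 → t ^ a = t ^ b) : a = b := by
  have hX : (Polynomial.X ^ (a + 1) : Polynomial K) = Polynomial.X ^ (b + 1) := by
    apply Polynomial.funext
    intro t
    by_cases ht : t = 0
    · simp [ht]
    · simp [pow_succ, h t ht]
  have := congrArg Polynomial.natDegree hX
  simpa using this

/-- The witness is `t` in position `i`, `t⁻¹` in position `j`, and `1` elsewhere. -/
theorem exists_diagonal_mem_sl {K : Type*} [Field K] {n : ℕ} {i j : Fin n} (hij : i ≠ j) {t : K}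
    (ht : t ≠ 0) : ∃ p : Fin n → K, (diagonal p).det = 1 ∧
      ∀ e : Fin n → ℕ, (∏ l, p l ^ e l = 1 → t ^ e i = t ^ e j) := by
  classical
  have hprod : ∀ e : Fin n → ℕ,
      ∏ l, (Function.update (Function.update 1 i t) j t⁻¹ : Fin n → K) l ^ e l =
        t ^ e i * (t⁻¹) ^ e j := by
    intro e
    rw [← Finset.prod_subset (Finset.subset_univ {i, j}), Finset.prod_pair hij]
    · simp [Function.update_of_ne hij]
    · intro l _ hl
      simp only [Finset.mem_insert, Finset.mem_singleton, not_or] at hl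
      simp [Function.update_of_ne hl.1, Function.update_of_ne hl.2]
  refine ⟨Function.update (Function.update 1 i t) j t⁻¹, ?_, fun e h => ?_⟩
  · rw [det_diagonal]
    simpa [ht] using hprod 1
  · rw [hprod] at h
    rwa [inv_pow, ← div_eq_mul_inv, div_eq_one_iff_eq (pow_ne_zero _ ht)] at h

theorem rowDeg_eq_of_mem_invariants {K : Type*} [Field K] [Infinite K] {n : ℕ} {f : Poly K n}
    (hf : f ∈ invariants K n) {d : Idx n →₀ ℕ} (hd : coeff d f ≠ 0) (i j : Fin n) :
    rowDeg d i = rowDeg d j := by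
  by_cases hij : i = j
  · rw [hij]
  refine eq_of_forall_pow_eq_pow (K := K) fun t ht => ?_
  obtain ⟨p, hp, h⟩ := exists_diagonal_mem_sl hij ht
  apply h
  have h1 : substHom (diagonal p) (diagonal fun _ => 1) f = f := by
    have := hf (⟨diagonal p, hp⟩, 1)
    simpa [slAction] using this
  have h2 := congrArg (coeff d) h1
  rw [coeff_substHom_diagonal, prod_weight_eq p fun _ => 1, mul_eq_right₀ hd] at h2
  simpa using h2

theorem colDeg_eq_of_mem_invariants {K : Type*} [Field K] [Infinite K] {n : ℕ} {f : Poly K n}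
    (hf : f ∈ invariants K n) {d : Idx n →₀ ℕ} (hd : coeff d f ≠ 0) (i j : Fin n) :
    colDeg d i = colDeg d j := by
  by_cases hij : i = j
  · rw [hij]
  refine eq_of_forall_pow_eq_pow (K := K) fun t ht => ?_
  obtain ⟨p, hp, h⟩ := exists_diagonal_mem_sl hij ht
  apply h
  have h1 : substHom (diagonal fun _ => 1) (diagonal p) f = f := by
    have := hf (1, ⟨diagonal p, hp⟩)
    simpa [slAction] using this
  have h2 := congrArg (coeff d) h1
  rw [coeff_substHom_diagonal, prod_weight_eq (fun _ => 1) p, mul_eq_right₀ hd] at h2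
  simpa using h2

/-- Every monomial of an invariant has the same degree in each row and in each column, so a pair of
diagonal matrices scales all of its terms of a given degree by a power of the product of the two
determinants. -/
theorem substHom_diagonal_of_mem_invariants {K : Type*} [Field K] [Infinite K] {n : ℕ}
    (hn : 1 ≤ n) {f : Poly K n} (hf : f ∈ invariants K n) {p q : Fin n → K}
    (hpq : (∏ i, p i) * ∏ j, q j = 1) : substHom (diagonal p) (diagonal q) f = f := by
  ext d
  rw [coeff_substHom_diagonal, prod_weight_eq]
  by_cases hd : coeff d f = 0
  · rw [hd, mul_zero]
  have hr := fun i => rowDeg_eq_of_mem_invariants hf hd i ⟨0, hn⟩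
  have hc := fun i => colDeg_eq_of_mem_invariants hf hd i ⟨0, hn⟩
  have hrc : rowDeg d ⟨0, hn⟩ = colDeg d ⟨0, hn⟩ := by
    have h := sum_rowDeg_eq_sum_colDeg d
    simp_rw [hr, hc] at h
    rw [Finset.sum_const, Finset.sum_const, Finset.card_univ, Fintype.card_fin, smul_eq_mul,
      smul_eq_mul] at h
    exact Nat.eq_of_mul_eq_mul_left hn h
  simp_rw [hr, hc]
  rw [hrc, Finset.prod_pow, Finset.prod_pow, ← mul_pow, hpq, one_pow, one_mul]

/-- An invariant of `SL × SL` is invariant under all `(P, Q) ∈ GL × GL` with `det P * det Q = 1`. -/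
theorem substHom_of_mem_invariants {K : Type*} [Field K] [Infinite K] {n : ℕ}
    (hn : 1 ≤ n) {f : Poly K n} (hf : f ∈ invariants K n) {P Q : Matrix (Fin n) (Fin n) K}
    (hPQ : P.det * Q.det = 1) : substHom P Q f = f := by
  -- Split off from each matrix a diagonal factor carrying its determinant.
  have key : ∀ M : Matrix (Fin n) (Fin n) K, M.det ≠ 0 →
      ∃ (S : SpecialLinearGroup (Fin n) K) (p : Fin n → K),
        M = (S : Matrix (Fin n) (Fin n) K) * diagonal p ∧ ∏ i, p i = M.det := by
    intro M hM
    have hu : ∀ c : K, ∏ i, (Function.update 1 (⟨0, hn⟩ : Fin n) c : Fin n → K) i = c := by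
      intro c
      rw [Finset.prod_update_of_mem (Finset.mem_univ _)]
      simp
    refine ⟨⟨M * diagonal (Function.update 1 ⟨0, hn⟩ M.det⁻¹), ?_⟩,
      Function.update 1 ⟨0, hn⟩ M.det, ?_, hu _⟩
    · rw [det_mul, det_diagonal, hu, mul_inv_cancel₀ hM]
    · change M = M * _ * _
      rw [Matrix.mul_assoc, diagonal_mul_diagonal]
      conv_lhs => rw [← Matrix.mul_one M, ← diagonal_one]
      congr 2
      funext i
      by_cases hi : i = ⟨0, hn⟩
      · subst hi
        simp [hM]
      · simp [Function.update_of_ne hi]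
  obtain ⟨S, p, hP, hp⟩ := key P (left_ne_zero_of_mul_eq_one hPQ)
  obtain ⟨S', q, hQ, hq⟩ := key Q (right_ne_zero_of_mul_eq_one hPQ)
  rw [hP, hQ, substHom_mul, AlgHom.comp_apply,
    substHom_diagonal_of_mem_invariants hn hf (by rw [hp, hq, hPQ])]
  exact hf (S, S')

/-! ### The normal form of a generic pencil -/

/-- The Krylov matrix of `A` and `v`, with columns `v, A v, A² v, …`. -/
def krylov {R : Type*} [CommRing R] {n : ℕ} (A : Matrix (Fin n) (Fin n) R) (v : Fin n → R) :
    Matrix (Fin n) (Fin n) R :=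
  Matrix.of fun i j => ((A ^ (j : ℕ)) *ᵥ v) i

theorem krylov_map {R S : Type*} [CommRing R] [CommRing S] {n : ℕ} (φ : R →+* S)
    (A : Matrix (Fin n) (Fin n) R) (v : Fin n → R) :
    (krylov A v).map φ = krylov (A.map φ) (φ ∘ v) := by
  ext i j
  have : A.map φ ^ (j : ℕ) = (A ^ (j : ℕ)).map φ := (map_pow φ.mapMatrix A j).symm
  simp only [krylov, Matrix.map_apply, Matrix.of_apply, this]
  exact RingHom.map_mulVec φ _ _ _

theorem krylov_smul {R : Type*} [CommRing R] {n : ℕ} (c : R) (A : Matrix (Fin n) (Fin n) R)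
    (v : Fin n → R) :
    krylov (c • A) v = krylov A v * diagonal fun j : Fin n => c ^ (j : ℕ) := by
  ext i j
  rw [mul_diagonal]
  simp [krylov, smul_pow, smul_mulVec, mul_comm]

theorem krylov_mulVec {R : Type*} [CommRing R] {n : ℕ} (A : Matrix (Fin n) (Fin n) R)
    (v c : Fin n → R) : krylov A v *ᵥ c = ∑ j, c j • (A ^ (j : ℕ)) *ᵥ v := by
  ext i
  simp [krylov, Matrix.mulVec, dotProduct, mul_comm, Finset.sum_apply]

/-- The pencil with `X = diag(1, …, 1, cₙ)` and with `Y` the matrix that has `-1` on the subdiagonal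
and last column `(c₀, …, cₙ₋₁)`. Its determinant `det (t X + Y)` is `∑ cₖ tᵏ`. -/
def companionPencil {R : Type*} [CommRing R] {n : ℕ} (c : Fin (n + 1) → R) (a : Idx n) : R :=
  if a.slc = 0 then
    if a.row = a.col then (if (a.col : ℕ) + 1 = n then c (Fin.last n) else 1) else 0
  else
    if (a.col : ℕ) + 1 = n then c a.row.castSucc
    else if (a.row : ℕ) = a.col + 1 then -1 else 0

theorem map_companionPencil {R S : Type*} [CommRing R] [CommRing S] {n : ℕ} (φ : R →+* S)
    (c : Fin (n + 1) → R) (a : Idx n) :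
    φ (companionPencil c a) = companionPencil (fun k => φ (c k)) a := by
  unfold companionPencil
  split_ifs <;> simp

theorem sliceAt_companionPencil_zero {R : Type*} [CommRing R] {n : ℕ} (c : Fin (n + 1) → R) :
    sliceAt (companionPencil c) 0 =
      diagonal fun j : Fin n => if (j : ℕ) + 1 = n then c (Fin.last n) else 1 := by
  ext i j
  change companionPencil c (idx i j 0) = _
  rw [diagonal_apply]
  simp only [companionPencil]
  change (if i = j then _ else _) = _
  by_cases h : i = j
  · subst h
    rfl
  · rw [if_neg h, if_neg h]

theorem sliceAt_companionPencil_one {R : Type*} [CommRing R] {n : ℕ} (c : Fin (n + 1) → R)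
    (i j : Fin n) : sliceAt (companionPencil c) 1 i j =
      if (j : ℕ) + 1 = n then c i.castSucc else if (i : ℕ) = j + 1 then -1 else 0 := rfl

/-- The Cayley–Hamilton theorem for `A = -X⁻¹ Y`, cleared of denominators. -/
theorem sum_smul_pow_eq_zero {K : Type*} [Field K] {n : ℕ} (x : Idx n → K)
    (A : Matrix (Fin n) (Fin n) K) (hA : sliceAt x 1 = -(sliceAt x 0 * A)) :
    ∑ k : Fin (n + 1), eval x (fComp K n k) • A ^ (k : ℕ) = 0 := by
  have hpoly : ∑ k : Fin (n + 1), Polynomial.C (eval x (fComp K n k)) * Polynomial.X ^ (k : ℕ) =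
      Polynomial.C (sliceAt x 0).det * A.charpoly := by
    rw [sum_eval_fComp_mul_X_pow, Matrix.charpoly, RingHom.map_det, ← det_mul]
    congr 1
    rw [charmatrix, hA, mul_sub, RingHom.mapMatrix_apply, RingHom.mapMatrix_apply,
      Matrix.scalar_apply, ← Matrix.smul_eq_mul_diagonal]
    ext1 i j
    simp [Matrix.mul_apply, sub_eq_add_neg, map_sum]
  have h := congrArg (Polynomial.aeval A) hpoly
  rw [map_mul, aeval_self_charpoly, mul_zero, map_sum] at h
  simpa [Algebra.smul_def] using h

theorem eval_fComp_last {K : Type*} [CommRing K] {n : ℕ} (x : Idx n → K) :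
    eval x (fComp K n (Fin.last n)) = (sliceAt x 0).det := by
  rw [eval_fComp_eq_coeff]
  have := Polynomial.coeff_det_X_add_C_card (sliceAt x 0) (sliceAt x 1)
  rwa [Fintype.card_fin] at this

/-- If `X` is invertible and `v` is a cyclic vector for `A = -X⁻¹ Y`, the pencil `(X, Y)` is
equivalent, under `(P, Q)` with `det P * det Q = 1`, to the companion pencil of the values
`f_{k, n-k}(X, Y)`. -/
theorem exists_transform_eq_companionPencil {K : Type*} [Field K] {n : ℕ}
    (x : Idx n → K) (A : Matrix (Fin n) (Fin n) K) (v : Fin n → K)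
    (hA : sliceAt x 1 = -(sliceAt x 0 * A)) (hX : (sliceAt x 0).det ≠ 0)
    (hW : (krylov A v).det ≠ 0) (hn : 1 ≤ n) :
    ∃ P Q : Matrix (Fin n) (Fin n) K, P.det * Q.det = 1 ∧
      ∀ l, Pᵀ * sliceAt x l * Q = sliceAt (companionPencil fun k => eval x (fComp K n k)) l := by
  set c : Fin (n + 1) → K := fun k => eval x (fComp K n k)
  set W := krylov A v with hWdef
  set D : Matrix (Fin n) (Fin n) K :=
    diagonal fun j : Fin n => if (j : ℕ) + 1 = n then c (Fin.last n) else 1 with hD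
  have hdetD : D.det = (sliceAt x 0).det := by
    rw [hD, det_diagonal, Finset.prod_eq_single ⟨n - 1, by omega⟩]
    · rw [if_pos (by simp; omega)]
      exact eval_fComp_last x
    · intro j _ hj
      rw [if_neg]
      intro h
      exact hj (Fin.ext (by simp; omega))
    · simp
  have hu : IsUnit (sliceAt x 0 * W).det := by
    rw [det_mul]
    exact (mul_ne_zero hX hW).isUnit
  refine ⟨((sliceAt x 0 * W)⁻¹)ᵀ, W * D, ?_, fun l => ?_⟩
  · rw [det_transpose, det_nonsing_inv, det_mul, det_mul, hdetD, Ring.inverse_eq_inv']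
    field_simp
  rw [transpose_transpose, Matrix.mul_assoc]
  -- It suffices that `X_l W D = (X W) S_l` for the slices `S_l` of the companion pencil.
  suffices h : sliceAt x l * (W * D) = sliceAt x 0 * W * sliceAt (companionPencil c) l by
    rw [h, ← Matrix.mul_assoc, nonsing_inv_mul _ hu, Matrix.one_mul]
  obtain rfl | rfl : l = 0 ∨ l = 1 := by
    revert l
    decide
  · rw [sliceAt_companionPencil_zero, Matrix.mul_assoc]
  rw [hA, Matrix.neg_mul, Matrix.mul_assoc, Matrix.mul_assoc, ← Matrix.mul_neg]
  congr 1
  ext i j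
  have hlhs : (-(A * (W * D))) i j =
      -((if (j : ℕ) + 1 = n then c (Fin.last n) else 1) * ((A ^ ((j : ℕ) + 1)) *ᵥ v) i) := by
    rw [← Matrix.mul_assoc, Matrix.neg_apply, hD, mul_diagonal, mul_comm, pow_succ', ← mulVec_mulVec]
    rfl
  have hrhs : (W * sliceAt (companionPencil c) 1) i j =
      (W *ᵥ fun l => sliceAt (companionPencil c) 1 l j) i := rfl
  rw [hlhs, hrhs]
  simp_rw [sliceAt_companionPencil_one]
  by_cases hj : (j : ℕ) + 1 = n
  · have hCH := congrFun (congrArg (· *ᵥ v) (sum_smul_pow_eq_zero x A hA)) i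
    rw [Fin.sum_univ_castSucc] at hCH
    simp only [hj, if_true]
    rw [krylov_mulVec]
    simp only [add_mulVec, zero_mulVec, sum_mulVec, Pi.add_apply, Pi.zero_apply, smul_mulVec,
      Fin.val_castSucc, Fin.val_last, Pi.smul_apply, smul_eq_mul] at hCH
    exact (eq_neg_of_add_eq_zero_left hCH).symm
  · simp only [hj, if_false, one_mul]
    have hj' : (j : ℕ) + 1 < n := by omega
    have : (fun l : Fin n => if (l : ℕ) = j + 1 then (-1 : K) else 0) =
        -Pi.single ⟨j + 1, hj'⟩ 1 := by
      ext l
      by_cases h : (l : ℕ) = j + 1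
      · obtain rfl : l = ⟨j + 1, hj'⟩ := Fin.ext h
        simp
      · have h' : l ≠ ⟨j + 1, hj'⟩ := fun h' => h (congrArg Fin.val h')
        simp [h, h']
    rw [this, mulVec_neg, mulVec_single_one]
    rfl

/-- The polynomial whose nonvanishing says that `X` is invertible and that the first basis vector
is cyclic for `X⁻¹ Y`. -/
noncomputable def genericity (K : Type*) [CommRing K] {n : ℕ} (hn : 1 ≤ n) : Poly K n :=
  (slice K n 0).det * (krylov (-(adjugate (slice K n 0) * slice K n 1)) (Pi.single ⟨0, hn⟩ 1)).det

theorem eval_genericity {K : Type*} [CommRing K] {n : ℕ} (hn : 1 ≤ n) (x : Idx n → K) :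
    eval x (genericity K hn) = (sliceAt x 0).det *
      (krylov (-(adjugate (sliceAt x 0) * sliceAt x 1)) (Pi.single ⟨0, hn⟩ 1)).det := by
  have hs : ∀ l, (slice K n l).map (eval x) = sliceAt x l := by
    intro l
    ext i j
    simp [slice, sliceAt]
  have hs' : ∀ l, (eval x).mapMatrix (slice K n l) = sliceAt x l := hs
  rw [genericity, map_mul, RingHom.map_det, RingHom.map_det, hs', RingHom.mapMatrix_apply,
    krylov_map, ← RingHom.mapMatrix_apply, map_neg, map_mul, RingHom.map_adjugate, hs', hs']
  congr 3
  ext i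
  rcases eq_or_ne i ⟨0, hn⟩ with rfl | h <;> simp [*]

theorem genericity_ne_zero (K : Type*) [Field K] {n : ℕ} (hn : 1 ≤ n) :
    genericity K hn ≠ 0 := by
  -- At `X = 1` and `Y` minus the nilpotent shift the Krylov matrix is the identity.
  set x : Idx n → K := fun a => if a.slc = 0 then (if a.row = a.col then 1 else 0) else
    if (a.row : ℕ) = a.col + 1 then -1 else 0 with hx
  have h0 : sliceAt x 0 = 1 := by
    ext i j
    rw [one_apply]
    rfl
  set N : Matrix (Fin n) (Fin n) K := -sliceAt x 1 with hN
  have hNe : ∀ j (hj : j < n), (N ^ j) *ᵥ Pi.single ⟨0, hn⟩ 1 = Pi.single ⟨j, hj⟩ (1 : K) := by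
    intro j
    induction j with
    | zero =>
      intro hj
      rw [pow_zero, one_mulVec]
    | succ j ih =>
      intro hj
      rw [pow_succ', ← mulVec_mulVec, ih (by omega), mulVec_single_one]
      ext i
      change -(if (i : ℕ) = j + 1 then (-1 : K) else 0) = _
      by_cases h : (i : ℕ) = j + 1
      · obtain rfl : i = ⟨j + 1, hj⟩ := Fin.ext h
        simp
      · have h' : i ≠ ⟨j + 1, hj⟩ := fun h' => h (congrArg Fin.val h')
        simp [h, h']
  have hkry : krylov N (Pi.single ⟨0, hn⟩ 1) = 1 := by
    ext i j
    change ((N ^ (j : ℕ)) *ᵥ Pi.single ⟨0, hn⟩ 1) i = _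
    rw [hNe j j.2, one_apply, Pi.single_apply]
  intro h
  have := eval_genericity hn x
  rw [h, h0, adjugate_one, Matrix.one_mul, ← hN, hkry] at this
  simp at this

/-- An invariant is recovered from the `f_{k, n-k}` by restricting it to companion pencils. -/
theorem aeval_companionPencil_of_mem_invariants {K : Type*} [Field K] [Infinite K] {n : ℕ}
    (hn : 1 ≤ n) {f : Poly K n} (hf : f ∈ invariants K n) :
    aeval (companionPencil (fComp K n)) f = f := by
  refine mul_right_cancel₀ (genericity_ne_zero K hn) (MvPolynomial.funext fun x => ?_)
  rw [map_mul, map_mul]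
  by_cases hg : eval x (genericity K hn) = 0
  · rw [hg, mul_zero, mul_zero]
  congr 1
  rw [eval_genericity] at hg
  have hX := left_ne_zero_of_mul hg
  have hW := right_ne_zero_of_mul hg
  set A : Matrix (Fin n) (Fin n) K := -((sliceAt x 0)⁻¹ * sliceAt x 1) with hA
  have hXA : sliceAt x 1 = -(sliceAt x 0 * A) := by
    rw [hA, Matrix.mul_neg, neg_neg, ← Matrix.mul_assoc, mul_nonsing_inv _ hX.isUnit,
      Matrix.one_mul]
  have hadj : -(adjugate (sliceAt x 0) * sliceAt x 1) = (sliceAt x 0).det • A := by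
    rw [hA, inv_def, Ring.inverse_eq_inv', Matrix.smul_mul, smul_neg, smul_smul,
      mul_inv_cancel₀ hX, one_smul]
  rw [hadj, krylov_smul, det_mul] at hW
  obtain ⟨P, Q, hPQ, htr⟩ :=
    exists_transform_eq_companionPencil x A _ hXA hX (left_ne_zero_of_mul hW) hn
  have h1 : eval x f = eval (companionPencil fun k => eval x (fComp K n k)) f := by
    conv_lhs => rw [← substHom_of_mem_invariants hn hf hPQ, eval_substHom]
    congr 2
    funext a
    rw [htr]
    rfl
  have h2 : eval x (aeval (companionPencil (fComp K n)) f) =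
      eval (companionPencil fun k => eval x (fComp K n k)) f := by
    have h : ((aeval x : Poly K n →ₐ[K] K).comp (aeval (companionPencil (fComp K n)))) =
        aeval (companionPencil fun k => eval x (fComp K n k)) := by
      apply MvPolynomial.algHom_ext
      intro a
      rw [AlgHom.comp_apply, aeval_X, aeval_X, aeval_eq_eval]
      exact map_companionPencil (eval x) _ a
    exact DFunLike.congr_fun h f
  rw [h1, h2]

theorem invariants_eq_adjoin (K : Type*) [Field K] [Infinite K] {n : ℕ} (hn : 1 ≤ n) :
    invariants K n = Algebra.adjoin K (Set.range (fComp K n)) := by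
  apply le_antisymm
  · intro f hf
    rw [← aeval_companionPencil_of_mem_invariants hn hf]
    have hmem : ∀ k, fComp K n k ∈ Algebra.adjoin K (Set.range (fComp K n)) := fun k =>
      Algebra.subset_adjoin ⟨k, rfl⟩
    have hle : Algebra.adjoin K (Set.range (companionPencil (fComp K n))) ≤
        Algebra.adjoin K (Set.range (fComp K n)) := by
      rw [Algebra.adjoin_le_iff]
      rintro _ ⟨a, rfl⟩
      unfold companionPencil
      split_ifs
      · exact hmem _
      · exact one_mem _
      · exact zero_mem _
      · exact hmem _
      · exact neg_mem (one_mem _)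
      · exact zero_mem _
    apply hle
    rw [Algebra.adjoin_range_eq_range_aeval]
    exact ⟨f, rfl⟩
  · rw [Algebra.adjoin_le_iff]
    rintro _ ⟨k, rfl⟩
    exact fComp_mem_invariants K n k

/-! ### The initial algebra -/

theorem exists_degree_aeval_fComp {K : Type*} [Field K] {n : ℕ} (hn : 1 ≤ n)
    {h : MvPolynomial (Fin (n + 1)) K} (hh : h ≠ 0) :
    aeval (fComp K n) h ≠ 0 ∧ ∃ e : Fin (n + 1) →₀ ℕ,
      (monOrder n).degree (aeval (fComp K n) h) =
        ∑ k, e k • (monOrder n).degree (fComp K n k) := by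
  refine exists_degree_aeval_eq (monOrder n) (fComp K n) monic_fComp ?_ hh
  simp_rw [degree_fComp]
  exact sum_smul_leadExp_injective hn

theorem algebraicIndependent_fComp (K : Type*) [Field K] {n : ℕ} (hn : 1 ≤ n) :
    AlgebraicIndependent K (fComp K n) := by
  rw [algebraicIndependent_iff]
  intro h h0
  by_contra hh
  exact (exists_degree_aeval_fComp hn hh).1 h0

theorem isSagbiBasis_fComp (K : Type*) [Field K] [Infinite K] {n : ℕ} (hn : 1 ≤ n) :
    IsSagbiBasis (monOrder n) (invariants K n) (Set.range (fComp K n)) := by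
  have hsub : Set.range (fComp K n) ⊆ invariants K n := by
    rintro _ ⟨k, rfl⟩
    exact fComp_mem_invariants K n k
  refine ⟨hsub, le_antisymm (Algebra.adjoin_mono (Set.image_mono fun f hf => ⟨hsub hf.1, hf.2⟩)) ?_⟩
  rw [Algebra.adjoin_le_iff]
  rintro _ ⟨f, ⟨hf, hf0⟩, rfl⟩
  rw [invariants_eq_adjoin K hn, Algebra.adjoin_range_eq_range_aeval] at hf
  obtain ⟨h, rfl⟩ := hf
  have hh : h ≠ 0 := by
    rintro rfl
    exact hf0 (map_zero _)
  obtain ⟨-, e, he⟩ := exists_degree_aeval_fComp hn hh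
  have hlm : leadMon (monOrder n) (aeval (fComp K n) h) =
      ∏ k, leadMon (monOrder n) (fComp K n k) ^ e k := by
    simp_rw [leadMon, he, monomial_pow, one_pow]
    rw [monomial_sum_one]
  change leadMon (monOrder n) (aeval (fComp K n) h) ∈ _
  rw [hlm]
  refine prod_mem fun k _ => pow_mem (Algebra.subset_adjoin ?_) _
  exact ⟨_, ⟨⟨k, rfl⟩, (monic_fComp k).ne_zero⟩, rfl⟩

end TensorInv

theorem mainTheorem1 (K : Type*) [Field K] [Infinite K] (n : ℕ) (hn : 1 ≤ n) :
    TensorInv.IsSagbiBasis (TensorInv.monOrder n) (TensorInv.invariants K n)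
        (Set.range (TensorInv.fComp K n)) ∧
      TensorInv.invariants K n = Algebra.adjoin K (Set.range (TensorInv.fComp K n)) ∧
      AlgebraicIndependent K (TensorInv.fComp K n) ∧
      Nonempty (TensorInv.invariants K n ≃ₐ[K] MvPolynomial (Fin (n + 1)) K) := by
  have hind := TensorInv.algebraicIndependent_fComp K hn
  refine ⟨TensorInv.isSagbiBasis_fComp K hn, TensorInv.invariants_eq_adjoin K hn, hind, ?_⟩
  rw [TensorInv.invariants_eq_adjoin K hn]
  exact ⟨hind.aevalEquiv.symm⟩
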